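/- Let $\mathbb L_\delta=\delta\mathbb Z\times\mathbb R\subset\mathbb C$ for $\delta>0$. For $\zeta=m+it\in\mathbb L_1$ ($m\in\mathbb Z$, $t\in\mathbb R$) put $$f_\zeta(z)=\frac1z\exp\Big[2it\Big(\frac1{z+1}+\frac1{z-1}\Big)\Big]\Big(\frac{z+1}{z-1}\Big)^{2m},\qquad G(\zeta)=\frac{1}{8\pi^2 i}\int_{C}f_\zeta(z)\ln z\,dz .$$ Here $\theta=\arg\zeta\in(-\pi,\pi]$ (with $\arg 0=0$), $\ln$ is the branch of the logarithm with imaginary part in $(\theta-\pi,\theta+\pi)$, and $C=C_\zeta$ is the counterclockwise boundary of the annular sector $$\{\rho e^{i\varphi}:\ \tfrac12\le\rho\le 2,\ |\varphi-\theta|\le\pi-\varepsilon\},$$ where $\varepsilon=\frac12\min(|\theta|,\pi-|\theta|)$ if $t\ne0$ and $\varepsilon=\frac\pi2$ if $t=0$. Thus $C$ avoids the branch cut, leaves the origin outside, and surrounds the points among $\pm1$ that are singularities of $f_\zeta$ (if $t\neq0$, also the arc of the unit circle that joins $1$ to $-1$ off the cut). By Cauchy's theorem any other simple loop with these properties gives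 the same value. The function $G$ is the semi-discrete Green's function on $\mathbb L_1$. For $\delta>0$ and $\zeta\in\mathbb L_\delta$ let $$G_\delta(\zeta)=G\Big(\frac\zeta\delta\Big)+\frac1{2\pi}\big(\ln\delta-\ln4-\gamma_{\rm Euler}\big)$$ be its rescaling to $\mathbb L_\delta$. Then: (1) as $|\zeta|\to\infty$, $\zeta\in\mathbb L_1$, $$G(\zeta)=\frac1{2\pi}\ln(4|\zeta|)+\frac{\gamma_{\rm Euler}}{2\pi}+O\Big(\frac1{|\zeta|^2}\Big);$$ (2) as $|\zeta|/\delta\to\infty$, $\delta>0$, $\zeta\in\mathbb L_\delta$, $$G_\delta(\zeta)=\frac1{2\pi}\ln|\zeta|+O\Big(\frac{\delta^2}{|\zeta|^2}\Big),$$ with a constant in the $O$ that does not depend on $\delta$. -/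

import Mathlib

noncomputable section

namespace SemiDiscrete

/-- The point `δ m + i t` of the semi-discrete primal lattice `𝕃_δ = δℤ × ℝ`, as a complex number.
A function on `𝕃_δ` is a function of `m : ℤ` and `t : ℝ`. -/
def point (δ : ℝ) (m : ℤ) (t : ℝ) : ℂ :=
  (δ : ℂ) * (m : ℂ) + (t : ℂ) * Complex.I

/-- The discrete exponential
`f_ζ(z) = z⁻¹ exp(2it (1/(z+1) + 1/(z-1))) ((z+1)/(z-1))^(2m)`, for `ζ = m + i t ∈ 𝕃₁`. -/
def discreteExp (m : ℤ) (t : ℝ) (z : ℂ) : ℂ :=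
  1 / z * Complex.exp (2 * Complex.I * (t : ℂ) * (1 / (z + 1) + 1 / (z - 1)))
    * ((z + 1) / (z - 1)) ^ (2 * m : ℤ)

/-- The branch of the complex logarithm with imaginary part in `(θ - π, θ + π]`; it is holomorphic
off the closed ray from `0` in the direction `-exp(iθ)`. -/
def logBranch (θ : ℝ) (z : ℂ) : ℂ :=
  Complex.log (z * Complex.exp (-((θ : ℂ) * Complex.I))) + (θ : ℂ) * Complex.I

/-- The contour integral of `h` along the arc `φ ↦ ρ exp(iφ)`, `φ` running from `a` to `b`. -/
def arcIntegral (h : ℂ → ℂ) (ρ a b : ℝ) : ℂ :=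
  ∫ φ in a..b, h ((ρ : ℂ) * Complex.exp ((φ : ℂ) * Complex.I))
    * ((ρ : ℂ) * Complex.I * Complex.exp ((φ : ℂ) * Complex.I))

/-- The contour integral of `h` along the radial segment `s ↦ s exp(iφ)`,
`s` running from `r` to `R`. -/
def radialIntegral (h : ℂ → ℂ) (φ r R : ℝ) : ℂ :=
  ∫ s in r..R, h ((s : ℂ) * Complex.exp ((φ : ℂ) * Complex.I))
    * Complex.exp ((φ : ℂ) * Complex.I)

/-- The contour integral of `h` along the counterclockwise boundary of the annular sector
`{ρ exp(iφ) : r ≤ ρ ≤ R, a ≤ φ ≤ b}`: outer arc, inward segment at angle `b`, inner arc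
backwards, outward segment at angle `a`. -/
def sectorIntegral (h : ℂ → ℂ) (r R a b : ℝ) : ℂ :=
  arcIntegral h R a b - radialIntegral h b r R - arcIntegral h r a b + radialIntegral h a r R

/-- An argument of the point `m + i t`. -/
def angle (m : ℤ) (t : ℝ) : ℝ := Complex.arg (point 1 m t)

/-- The angle that the contour for `ζ = m + i t` keeps from the branch cut (the ray through `-ζ`).
If `t ≠ 0`, it is half of the angle between the cut and the real axis, so that the open sector
contains both `1` and `-1`, together with the arc of the unit circle joining them off the cut.
If `t = 0`, one of `±1` lies on the cut, but there `f_ζ` has no pole, and the sector contains the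
other. -/
def gap (m : ℤ) (t : ℝ) : ℝ :=
  if t = 0 then Real.pi / 2 else min |angle m t| (Real.pi - |angle m t|) / 2

/-- The semi-discrete Green's function on `𝕃₁`, at `ζ = m + i t`:
`G(ζ) = (8π²i)⁻¹ ∫_C f_ζ(z) ln z dz`, with the branch of `ln` on `(θ - π, θ + π)`, `θ` an argument
of `ζ`, where `C` is a positively oriented loop off the branch cut (so `0` is outside it) that
surrounds the poles of `f_ζ` on the unit circle. -/
def green (m : ℤ) (t : ℝ) : ℂ :=
  1 / (8 * (Real.pi : ℂ) ^ 2 * Complex.I)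
    * sectorIntegral (fun z => discreteExp m t z * logBranch (angle m t) z) (1 / 2) 2
        (angle m t - Real.pi + gap m t) (angle m t + Real.pi - gap m t)

/-- The free Green's function on `𝕃_δ`, at `ζ = δ m + i t`:
`G_δ(ζ) = G(ζ / δ) + (ln δ - ln 4 - γ) / (2π)`. Note `ζ / δ = m + i (t / δ)`. -/
def greenScaled (δ : ℝ) (m : ℤ) (t : ℝ) : ℂ :=
  green m (t / δ)
    + (((Real.log δ - Real.log 4 - Real.eulerMascheroniConstant) / (2 * Real.pi) : ℝ) : ℂ)

end SemiDiscrete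

end

noncomputable section

open MeasureTheory Filter Topology Set

namespace SemiDiscrete

/-! In the coordinate `z = exp w` the contour becomes a rectangle and the integrand becomes `F(exp
w) * w` with `F(z) = z f(z)`. Since `w` replaces the logarithm, the rectangle can be stretched to
`[-L, L] × [θ - π, θ + π]`, whose horizontal sides are the two lips of the branch cut. There `F`
takes equal values while `w` jumps by `2πi`. On the vertical sides `F → 1`, as `F(0) = F(∞) = 1`.
Hence `4πG = lim (2L - ∫_{-L}^{L} F)`, with `F` restricted to the cut
(`tendsto_sub_integral_cutKernel`).

Let `r = |ζ|`. At the point `-s exp(iθ)` of the cut, `log F` is `4 conj(ζ) z = -4rs` up to a cubic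
remainder, because both parts of `log F` are odd in `z`. So `F` differs from `exp(-4rs)` by `O(r s³
exp(-2rs))` for `s ≤ 1` (`norm_kernel_sub_exp_le`), which integrates to `O(r⁻²)` against `ds/s`. The
reflection `z ↦ 1/conj z` conjugates `F` and turns `s ≥ 1` into `s ≤ 1`. Each half of the cut then
contributes the regularized exponential integral `ln(4r) + γ + O(r⁻²)`
(`tendsto_sub_integral_exp_neg_mul_exp`), where `γ` enters as `-Γ'(1)`. Part (2) is a rescaling of
part (1). -/

/-! ### Real integrals: Euler's constant and the exponential integral -/

theorem integral_exp_substitution (g : ℝ → ℂ) {a b : ℝ} (hab : a ≤ b) :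
    ∫ s in Real.exp a..Real.exp b, g s = ∫ x in a..b, (Real.exp x : ℂ) * g (Real.exp x) := by
  have himage : Real.exp '' Icc a b = Icc (Real.exp a) (Real.exp b) := by
    ext y
    constructor
    · rintro ⟨x, ⟨h1, h2⟩, rfl⟩
      exact ⟨Real.exp_le_exp.2 h1, Real.exp_le_exp.2 h2⟩
    · rintro ⟨h1, h2⟩
      have hy : 0 < y := (Real.exp_pos a).trans_le h1
      exact ⟨Real.log y, ⟨(Real.le_log_iff_exp_le hy).2 h1, (Real.log_le_iff_le_exp hy).2 h2⟩,
        Real.exp_log hy⟩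
  rw [intervalIntegral.integral_of_le (Real.exp_le_exp.2 hab), intervalIntegral.integral_of_le hab,
    ← integral_Icc_eq_integral_Ioc, ← integral_Icc_eq_integral_Ioc, ← himage,
    integral_image_eq_integral_abs_deriv_smul measurableSet_Icc
      (fun x _ => (Real.hasDerivAt_exp x).hasDerivWithinAt) Real.exp_injective.injOn]
  refine integral_congr_ae (Eventually.of_forall fun x => ?_)
  simp only [abs_of_pos (Real.exp_pos x), Complex.real_smul]

theorem integral_exp_substitution_real (g : ℝ → ℝ) {a b : ℝ} (hab : a ≤ b) :
    ∫ s in Real.exp a..Real.exp b, g s = ∫ x in a..b, Real.exp x * g (Real.exp x) := by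
  have h := integral_exp_substitution (fun s => (g s : ℂ)) hab
  simp only [← Complex.ofReal_mul] at h
  rw [intervalIntegral.integral_ofReal, intervalIntegral.integral_ofReal] at h
  exact_mod_cast h

/-- The integral is `Γ'(1)`, by differentiation of Euler's integral under the integral sign. -/
theorem integral_log_mul_exp_neg :
    ∫ u in Ioi (0 : ℝ), Real.log u * Real.exp (-u) = -Real.eulerMascheroniConstant := by
  have h1 := Complex.hasDerivAt_GammaIntegral (s := 1) (by simp)
  have h2 : Complex.Gamma =ᶠ[𝓝 1] Complex.GammaIntegral := by
    have : {s : ℂ | 0 < s.re} ∈ 𝓝 (1 : ℂ) :=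
      (isOpen_lt continuous_const Complex.continuous_re).mem_nhds (by simp)
    filter_upwards [this] with s hs using Complex.Gamma_eq_integral hs
  have h3 := (h1.congr_of_eventuallyEq h2).unique Complex.hasDerivAt_Gamma_one
  simp only [sub_self, Complex.cpow_zero, one_mul, ← Complex.ofReal_mul] at h3
  rw [integral_complex_ofReal] at h3
  exact_mod_cast h3

theorem integrableOn_log_mul_exp_neg :
    IntegrableOn (fun u : ℝ => Real.log u * Real.exp (-u)) (Ioi 0) := by
  by_contra h
  have h1 := integral_log_mul_exp_neg
  -- A nonintegrable function has integral `0` by convention, but the value is `-γ ≠ 0`.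
  rw [integral_undef h] at h1
  linarith [Real.one_half_lt_eulerMascheroniConstant]

theorem integral_exp_neg_exp (p q : ℝ) (hpq : p ≤ q) :
    ∫ y in p..q, Real.exp (-Real.exp y)
      = q * Real.exp (-Real.exp q) - p * Real.exp (-Real.exp p)
        + ∫ u in Real.exp p..Real.exp q, Real.log u * Real.exp (-u) := by
  rw [integral_exp_substitution_real _ hpq]
  have hd : ∀ y : ℝ, HasDerivAt (fun y => y * Real.exp (-Real.exp y))
      (Real.exp (-Real.exp y) - Real.exp y * (Real.log (Real.exp y) * Real.exp (-Real.exp y))) y := by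
    intro y
    convert! (hasDerivAt_id y).mul (Real.hasDerivAt_exp y).neg.exp using 1
    simp only [Real.log_exp, id, one_mul, Pi.neg_apply]
    ring
  have hc1 : Continuous fun y => Real.exp (-Real.exp y) := by fun_prop
  have hc2 : Continuous fun y => Real.exp y * (Real.log (Real.exp y) * Real.exp (-Real.exp y)) := by
    simp only [Real.log_exp]
    fun_prop
  have h := intervalIntegral.integral_eq_sub_of_hasDerivAt (fun y _ => hd y)
    ((hc1.sub hc2).intervalIntegrable p q)
  rw [intervalIntegral.integral_sub (hc1.intervalIntegrable _ _) (hc2.intervalIntegrable _ _)] at h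
  linarith

/-- The error term in the asymptotics of the exponential integral. -/
def expIntegralTail (a : ℝ) : ℝ :=
  (∫ u in Ioi a, Real.log u * Real.exp (-u)) - Real.log a * Real.exp (-a)

/-- The two terms of the tail both lie in `[0, 2 exp(-a/2)]`, hence so does the absolute value of
their difference. The decay is exponential; only the inverse square is needed. -/
theorem abs_expIntegralTail_le {a : ℝ} (ha : 1 ≤ a) : |expIntegralTail a| ≤ 18 / a ^ 2 := by
  have ha0 : 0 < a := by linarith
  have hI : IntegrableOn (fun u : ℝ => Real.exp (-(1/2 : ℝ) * u)) (Ioi a) :=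
    exp_neg_integrableOn_Ioi a (by norm_num)
  have hlog : ∀ u : ℝ, a ≤ u → 0 ≤ Real.log u * Real.exp (-u) ∧
      Real.log u * Real.exp (-u) ≤ Real.exp (-(1/2 : ℝ) * u) := by
    intro u hu
    have hu0 : 0 < u := by linarith
    refine ⟨mul_nonneg (Real.log_nonneg (by linarith)) (Real.exp_pos _).le, ?_⟩
    have h1 : Real.log u ≤ Real.exp (u / 2) := by
      nlinarith [Real.log_le_sub_one_of_pos hu0,
        Real.quadratic_le_exp_of_nonneg (x := u / 2) (by positivity), sq_nonneg (u - 2)]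
    calc Real.log u * Real.exp (-u) ≤ Real.exp (u / 2) * Real.exp (-u) := by gcongr
      _ = Real.exp (-(1/2 : ℝ) * u) := by rw [← Real.exp_add]; ring_nf
  have hlow : 0 ≤ ∫ u in Ioi a, Real.log u * Real.exp (-u) :=
    setIntegral_nonneg measurableSet_Ioi fun u hu => (hlog u (le_of_lt hu)).1
  have hup : ∫ u in Ioi a, Real.log u * Real.exp (-u) ≤ 2 * Real.exp (-(1/2 : ℝ) * a) := by
    calc ∫ u in Ioi a, Real.log u * Real.exp (-u)
        ≤ ∫ u in Ioi a, Real.exp (-(1/2 : ℝ) * u) :=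
          setIntegral_mono_on (integrableOn_log_mul_exp_neg.mono_set (Ioi_subset_Ioi ha0.le)) hI
            measurableSet_Ioi fun u hu => (hlog u (le_of_lt hu)).2
      _ = 2 * Real.exp (-(1/2 : ℝ) * a) := by
          rw [integral_exp_mul_Ioi (by norm_num)]
          ring
  have hexp : 2 * Real.exp (-(1/2 : ℝ) * a) ≤ 18 / a ^ 2 := by
    have h1 := Real.quadratic_le_exp_of_nonneg (x := a / 2) (by positivity)
    have h2 : a ^ 2 / 8 ≤ Real.exp (a / 2) := by nlinarith
    rw [show -(1/2 : ℝ) * a = -(a / 2) by ring, Real.exp_neg, ← div_eq_mul_inv,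
      div_le_div_iff₀ (Real.exp_pos _) (by positivity)]
    nlinarith
  obtain ⟨h1, h2⟩ := hlog a le_rfl
  rw [expIntegralTail, abs_le]
  have := Real.exp_pos (-(1/2 : ℝ) * a)
  constructor <;> linarith

/-- The shift `y = x + log a` absorbs `a`, and integration by parts (`integral_exp_neg_exp`) leaves
an integral of `log u * exp(-u)` over an interval that grows to `(0, a)`. That limit is `-γ` minus
the part over `(a, ∞)`. -/
theorem tendsto_sub_integral_exp_neg_mul_exp {a : ℝ} (ha : 0 < a) :
    Tendsto (fun L : ℝ => L - ∫ x in (-L)..0, Real.exp (-(a * Real.exp x))) atTop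
      (𝓝 (Real.log a + Real.eulerMascheroniConstant + expIntegralTail a)) := by
  set A := Real.log a with hA
  have hexpA : Real.exp A = a := Real.exp_log ha
  have key : ∀ L : ℝ, 0 ≤ L → L - ∫ x in (-L)..0, Real.exp (-(a * Real.exp x))
      = L + (A - L) * Real.exp (-Real.exp (A - L)) - A * Real.exp (-a)
        - ∫ u in Real.exp (A - L)..a, Real.log u * Real.exp (-u) := by
    intro L hL
    have h := integral_exp_neg_exp (A - L) A (by linarith)
    have h2 : ∫ x in (-L)..0, Real.exp (-(a * Real.exp x)) = ∫ y in (A - L)..A, Real.exp (-Real.exp y) := by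
      have := intervalIntegral.integral_comp_add_right (a := -L) (b := 0)
        (fun y => Real.exp (-Real.exp y)) A
      simp only [Real.exp_add, hexpA] at this
      rw [zero_add, neg_add_eq_sub] at this
      rw [← this]
      simp only [mul_comm]
    rw [h2, h, hexpA]
    ring
  have hexp0 : Tendsto (fun L : ℝ => Real.exp (A - L)) atTop (𝓝 0) := by
    have := (Real.tendsto_exp_neg_atTop_nhds_zero).const_mul a
    simpa [sub_eq_add_neg, Real.exp_add, hexpA] using this
  have hint : Tendsto (fun L : ℝ => ∫ u in Real.exp (A - L)..a, Real.log u * Real.exp (-u)) atTop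
      (𝓝 (∫ u in (0:ℝ)..a, Real.log u * Real.exp (-u))) := by
    -- Integrability is known on `(0, ∞)` only; the indicator makes the primitive continuous on the
    -- whole line, in particular at `0`.
    have hc : Continuous fun x : ℝ => ∫ u in x..a, indicator (Ioi 0)
        (fun u => Real.log u * Real.exp (-u)) u := by
      have : Integrable (indicator (Ioi 0) fun u : ℝ => Real.log u * Real.exp (-u)) :=
        integrableOn_log_mul_exp_neg.integrable_indicator measurableSet_Ioi
      simp only [fun x : ℝ => intervalIntegral.integral_symm (μ := volume) (f := indicator (Ioi 0)
        (fun u => Real.log u * Real.exp (-u))) a x]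
      exact (this.continuous_primitive a).neg
    have h1 : ∀ x : ℝ, 0 ≤ x → x ≤ a → ∫ u in x..a, indicator (Ioi 0)
        (fun u => Real.log u * Real.exp (-u)) u = ∫ u in x..a, Real.log u * Real.exp (-u) := by
      intro x hx hxa
      rw [intervalIntegral.integral_of_le hxa, intervalIntegral.integral_of_le hxa]
      refine setIntegral_congr_fun measurableSet_Ioc fun u hu => ?_
      exact indicator_of_mem (mem_Ioi.2 (hx.trans_lt hu.1)) _
    have h2 := (hc.tendsto 0).comp hexp0
    rw [h1 0 le_rfl ha.le] at h2
    refine h2.congr' ?_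
    filter_upwards [eventually_ge_atTop 0] with L hL
    refine h1 _ (Real.exp_pos _).le ?_
    rw [← hexpA]
    exact Real.exp_le_exp.2 (by linarith)
  have hfull : ∫ u in (0:ℝ)..a, Real.log u * Real.exp (-u)
      = -Real.eulerMascheroniConstant - ∫ u in Ioi a, Real.log u * Real.exp (-u) := by
    rw [← integral_log_mul_exp_neg, ← intervalIntegral.integral_Ioi_sub_Ioi
      integrableOn_log_mul_exp_neg ha.le]
  have hel : Tendsto (fun L : ℝ => L + (A - L) * Real.exp (-Real.exp (A - L))) atTop (𝓝 A) := by
    have h0 : Tendsto (fun L : ℝ => (L - A) * Real.exp (A - L)) atTop (𝓝 0) := by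
      have h1 := (Real.tendsto_pow_mul_exp_neg_atTop_nhds_zero 1).comp
        (tendsto_atTop_add_const_right atTop (-A) tendsto_id)
      refine h1.congr fun L => ?_
      simp only [Function.comp_apply, id, pow_one]
      ring_nf
    rw [tendsto_iff_norm_sub_tendsto_zero]
    refine squeeze_zero' (Eventually.of_forall fun _ => norm_nonneg _) ?_ h0
    filter_upwards [eventually_ge_atTop A] with L hL
    have h1 : L + (A - L) * Real.exp (-Real.exp (A - L)) - A
        = (L - A) * (1 - Real.exp (-Real.exp (A - L))) := by ring
    have h2 := Real.add_one_le_exp (-Real.exp (A - L))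
    have h3 : Real.exp (-Real.exp (A - L)) ≤ 1 := Real.exp_le_one_iff.2 (by
      linarith [Real.exp_pos (A - L)])
    rw [h1, Real.norm_eq_abs, abs_of_nonneg (mul_nonneg (by linarith) (by linarith))]
    exact mul_le_mul_of_nonneg_left (by linarith) (by linarith)
  have := (hel.sub_const (A * Real.exp (-a))).sub hint
  refine (this.congr' ?_).trans (le_of_eq ?_)
  · filter_upwards [eventually_ge_atTop 0] with L hL using (key L hL).symm
  · rw [hfull, expIntegralTail]
    congr 1
    ring

/-- With `s = exp x` this is part of `∫_0^∞ r s² exp(-2rs) ds = 1/(4r²)`. The bound is uniform in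
`L`, so it survives the limit. -/
theorem integral_cubic_exp_le {r : ℝ} (hr : 0 < r) (L : ℝ) :
    ∫ x in (-L)..0, r * Real.exp x ^ 3 * Real.exp (-(2 * r * Real.exp x)) ≤ 1 / (4 * r ^ 2) := by
  have hd : ∀ x : ℝ, HasDerivAt (fun x => -Real.exp (-(2 * r * Real.exp x))
      * (Real.exp x ^ 2 / 2 + Real.exp x / (2 * r) + 1 / (4 * r ^ 2)))
      (r * Real.exp x ^ 3 * Real.exp (-(2 * r * Real.exp x))) x := by
    intro x
    have h1 := Real.hasDerivAt_exp x
    convert! ((h1.const_mul (2 * r)).neg.exp.neg).mul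
      ((((h1.pow 2).div_const 2).add (h1.div_const (2 * r))).add_const (1 / (4 * r ^ 2))) using 1
    simp only [Pi.neg_apply, Pi.add_apply, Pi.pow_apply]
    field_simp
    ring
  rw [intervalIntegral.integral_eq_sub_of_hasDerivAt (fun x _ => hd x)
    (Continuous.intervalIntegrable (by fun_prop) _ _)]
  have h1 : 0 ≤ Real.exp (-(2 * r * Real.exp 0))
      * (Real.exp 0 ^ 2 / 2 + Real.exp 0 / (2 * r) + 1 / (4 * r ^ 2)) := by positivity
  set s := Real.exp (-L) with hs
  have hs0 : 0 < s := Real.exp_pos _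
  have h2 : Real.exp (-(2 * r * s)) * (s ^ 2 / 2 + s / (2 * r) + 1 / (4 * r ^ 2)) ≤ 1 / (4 * r ^ 2) := by
    have h3 : 1 + 2 * r * s + (2 * r * s) ^ 2 / 2 ≤ Real.exp (2 * r * s) :=
      Real.quadratic_le_exp_of_nonneg (by positivity)
    have h4 : s ^ 2 / 2 + s / (2 * r) + 1 / (4 * r ^ 2)
        = (1 + 2 * r * s + (2 * r * s) ^ 2 / 2) * (1 / (4 * r ^ 2)) := by
      field_simp
      ring
    rw [h4, Real.exp_neg, ← mul_assoc]
    have h5 : (Real.exp (2 * r * s))⁻¹ * (1 + 2 * r * s + (2 * r * s) ^ 2 / 2) ≤ 1 := by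
      rw [inv_mul_le_iff₀ (Real.exp_pos _)]; linarith
    exact mul_le_of_le_one_left (by positivity) h5
  linarith

/-! ### The kernel: symmetries and estimates along the cut -/

/-- `z` times the discrete exponential. -/
def kernel (m : ℤ) (t : ℝ) (z : ℂ) : ℂ :=
  Complex.exp (2 * Complex.I * (t : ℂ) * (1 / (z + 1) + 1 / (z - 1)))
    * ((z + 1) / (z - 1)) ^ (2 * m : ℤ)

theorem discreteExp_mul_self (m : ℤ) (t : ℝ) {z : ℂ} (hz : z ≠ 0) :
    discreteExp m t z * z = kernel m t z := by
  rw [discreteExp, kernel]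
  field_simp

theorem kernel_inv (m : ℤ) (t : ℝ) {z : ℂ} (hz : z ≠ 0) (h1 : z ≠ 1) (h2 : z ≠ -1) :
    kernel m t z⁻¹ = kernel m (-t) z := by
  have h1' : z - 1 ≠ 0 := sub_ne_zero.2 h1
  have h1'' : 1 - z ≠ 0 := sub_ne_zero.2 h1.symm
  have h2' : z + 1 ≠ 0 := fun h => h2 (eq_neg_of_add_eq_zero_left h)
  have h2'' : 1 + z ≠ 0 := by rwa [add_comm]
  have e1 : z⁻¹ + 1 = (1 + z) / z := by field_simp
  have e2 : z⁻¹ - 1 = (1 - z) / z := by field_simp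
  have e3 : (z⁻¹ + 1) / (z⁻¹ - 1) = -((z + 1) / (z - 1)) := by
    rw [e1, e2, div_div_div_cancel_right₀ hz, add_comm, ← div_neg, neg_sub]
  have e4 : (1 : ℂ) / (z⁻¹ + 1) + 1 / (z⁻¹ - 1) = -(1 / (z + 1) + 1 / (z - 1)) := by
    rw [e1, e2, one_div_div, one_div_div, ← neg_sub z 1, div_neg, add_comm 1 z]
    field_simp
    ring
  rw [kernel, kernel, e3, e4, (even_two_mul m).neg_zpow]
  congr 2
  push_cast
  ring

/-- Combined with `kernel_inv`, this shows that the reflection `z ↦ 1/conj z` in the unit circle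
conjugates the kernel. -/
theorem conj_kernel (m : ℤ) (t : ℝ) (z : ℂ) :
    (starRingEnd ℂ) (kernel m t z) = kernel m (-t) ((starRingEnd ℂ) z) := by
  simp only [kernel, map_mul, map_zpow₀, map_div₀, map_add, map_sub, map_one, ← Complex.exp_conj,
    Complex.conj_I, Complex.conj_ofReal, map_ofNat, Complex.ofReal_neg, mul_neg, neg_mul]

/-- For `0 ≤ v < 1`, the first term of the positive series of `log((1+v)/(1-v))` gives `2v` as a
lower bound. The sign condition reduces negative `m` to `-m`, `-u`. -/
theorem one_sub_div_one_add_zpow_le (m : ℤ) {u : ℝ} (hu : |u| ≤ 1) (hmu : 0 ≤ (m : ℝ) * u) :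
    ((1 - u) / (1 + u)) ^ m ≤ Real.exp (-(2 * u * m)) := by
  have base : ∀ v : ℝ, 0 ≤ v → v ≤ 1 → (1 - v) / (1 + v) ≤ Real.exp (-(2 * v)) := by
    intro v hv0 hv1
    rcases hv1.eq_or_lt with rfl | hv1
    · simpa using (Real.exp_pos _).le
    have hs := Real.hasSum_log_sub_log_of_abs_lt_one (x := v) (by rwa [abs_of_nonneg hv0])
    have h1 := le_hasSum hs 0 fun k _ => by positivity
    have h2 : 2 * v ≤ Real.log (1 + v) - Real.log (1 - v) := by simpa using h1
    rw [← Real.exp_log (show 0 < 1 - v by linarith), ← Real.exp_log (show 0 < 1 + v by linarith),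
      ← Real.exp_sub]
    apply Real.exp_le_exp.2
    linarith
  have natural : ∀ (n : ℕ) (v : ℝ), 0 ≤ v → v ≤ 1 →
      ((1 - v) / (1 + v)) ^ n ≤ Real.exp (-(2 * v * n)) := by
    intro n v hv0 hv1
    calc ((1 - v) / (1 + v)) ^ n ≤ Real.exp (-(2 * v)) ^ n :=
          pow_le_pow_left₀ (div_nonneg (by linarith) (by linarith)) (base v hv0 hv1) n
      _ = _ := by rw [← Real.exp_nat_mul]; ring_nf
  obtain ⟨hl, hr⟩ := abs_le.1 hu
  obtain ⟨n, rfl | rfl⟩ := m.eq_nat_or_neg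
  · rcases n.eq_zero_or_pos with rfl | hn
    · simp
    have hn' : (0 : ℝ) < n := by exact_mod_cast hn
    rw [zpow_natCast]
    have hu0 : 0 ≤ u := by
      push_cast at hmu
      exact nonneg_of_mul_nonneg_right hmu hn'
    simpa using natural n u hu0 hr
  · rcases n.eq_zero_or_pos with rfl | hn
    · simp
    have hn' : (0 : ℝ) < n := by exact_mod_cast hn
    have hu0 : 0 ≤ -u := by
      push_cast at hmu
      refine nonneg_of_mul_nonneg_right (a := (n : ℝ)) ?_ hn'
      linarith
    have := natural n (-u) hu0 (by linarith)
    rw [zpow_neg, zpow_natCast, ← inv_pow, inv_div]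
    convert this using 2
    · ring
    · push_cast; ring

/-- The exponential factor supplies the share `σ²` of the exponent and the power supplies the share
`c²`; the shares add up to one. -/
theorem norm_kernel_le {m : ℤ} {t r c σ s : ℝ} (hr : 0 ≤ r) (hs : 0 < s) (hcσ : c ^ 2 + σ ^ 2 = 1)
    (hm : (m : ℝ) = r * c) (ht : t = r * σ) :
    ‖kernel m t (-(s * (c + σ * Complex.I)))‖ ≤ Real.exp (-(4 * r * s / (1 + s ^ 2))) := by
  set z : ℂ := -(s * (c + σ * Complex.I)) with hz
  have hre : z.re = -(s * c) := by simp [hz]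
  have him : z.im = -(s * σ) := by simp [hz]
  set A := Complex.normSq (z + 1) with hA
  set B := Complex.normSq (z - 1) with hB
  have hA' : A = 1 + s ^ 2 - 2 * s * c := by
    rw [hA, Complex.normSq_apply]
    simp only [Complex.add_re, Complex.add_im, Complex.one_re, Complex.one_im, hre, him]
    linear_combination s ^ 2 * hcσ
  have hB' : B = 1 + s ^ 2 + 2 * s * c := by
    rw [hB, Complex.normSq_apply]
    simp only [Complex.sub_re, Complex.sub_im, Complex.one_re, Complex.one_im, hre, him]
    linear_combination s ^ 2 * hcσ
  have hA0 : 0 ≤ A := Complex.normSq_nonneg _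
  have hB0 : 0 ≤ B := Complex.normSq_nonneg _
  have hS : 0 < 1 + s ^ 2 := by positivity
  have hexp : (2 * Complex.I * (t : ℂ) * (1 / (z + 1) + 1 / (z - 1))).re
      ≤ -(4 * r * s * σ ^ 2 / (1 + s ^ 2)) := by
    have h1 : (2 * Complex.I * (t : ℂ) * (1 / (z + 1) + 1 / (z - 1))).re
        = -(2 * r * s * (σ ^ 2 * (1 / A + 1 / B))) := by
      have : (2 * Complex.I * (t : ℂ) * (1 / (z + 1) + 1 / (z - 1)))
        = ((2 * t : ℝ) : ℂ) * (Complex.I * (1 / (z + 1) + 1 / (z - 1))) := by push_cast; ring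
      rw [this, Complex.re_ofReal_mul, Complex.I_mul_re, Complex.add_im, one_div, one_div,
        Complex.inv_im, Complex.inv_im, ← hA, ← hB]
      simp only [Complex.add_im, Complex.sub_im, Complex.one_im, him, ht]
      ring
    -- This is `1/A + 1/B ≥ 4/(A + B)`. A zero of `A` or `B` forces `σ = 0`, where both sides
    -- vanish.
    have h2 : 2 * σ ^ 2 / (1 + s ^ 2) ≤ σ ^ 2 * (1 / A + 1 / B) := by
      rcases eq_or_ne σ 0 with rfl | hσ
      · simp
      have hApos : 0 < A := by
        refine Complex.normSq_pos.2 fun h => ?_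
        have := congrArg Complex.im h
        simp [him, hs.ne', hσ] at this
      have hBpos : 0 < B := by
        refine Complex.normSq_pos.2 fun h => ?_
        have := congrArg Complex.im h
        simp [him, hs.ne', hσ] at this
      have hAB : 1 + s ^ 2 = (A + B) / 2 := by rw [hA', hB']; ring
      rw [mul_comm 2, mul_div_assoc]
      apply mul_le_mul_of_nonneg_left _ (sq_nonneg σ)
      rw [hAB, div_add_div _ _ hApos.ne' hBpos.ne', div_le_div_iff₀ (by positivity) (by positivity)]
      nlinarith [sq_nonneg (A - B)]
    rw [h1, neg_le_neg_iff]
    calc 4 * r * s * σ ^ 2 / (1 + s ^ 2) = 2 * r * s * (2 * σ ^ 2 / (1 + s ^ 2)) := by ring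
      _ ≤ _ := mul_le_mul_of_nonneg_left h2 (by positivity)
  have hpow : ‖((z + 1) / (z - 1)) ^ (2 * m : ℤ)‖ ≤ Real.exp (-(4 * r * s * c ^ 2 / (1 + s ^ 2))) := by
    have h1 : ‖((z + 1) / (z - 1)) ^ (2 * m : ℤ)‖ = (A / B) ^ m := by
      rw [norm_zpow, zpow_mul, norm_div]
      congr 1
      rw [zpow_ofNat, div_pow, Complex.sq_norm, Complex.sq_norm]
    set u := 2 * s * c / (1 + s ^ 2) with hu
    have h2 : A / B = (1 - u) / (1 + u) := by
      rw [hA', hB', hu, one_sub_div hS.ne', one_add_div hS.ne', div_div_div_cancel_right₀ hS.ne']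
    have h3 : |u| ≤ 1 := by
      rw [abs_le, hu, le_div_iff₀ hS, div_le_iff₀ hS]
      constructor <;> linarith
    rw [h1, h2]
    refine (one_sub_div_one_add_zpow_le m h3 ?_).trans (le_of_eq ?_)
    · rw [hm, hu]
      have : r * c * (2 * s * c / (1 + s ^ 2)) = r * c ^ 2 * (2 * s) / (1 + s ^ 2) := by ring
      rw [this]; positivity
    · rw [hm, hu]; ring_nf
  rw [kernel, norm_mul, Complex.norm_exp]
  calc _ ≤ Real.exp (-(4 * r * s * σ ^ 2 / (1 + s ^ 2)))
        * Real.exp (-(4 * r * s * c ^ 2 / (1 + s ^ 2))) := by gcongr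
    _ = _ := by
      rw [← Real.exp_add]
      congr 1
      rw [← neg_add, ← add_div, ← mul_add, add_comm (σ ^ 2), hcσ, mul_one]

/-- The quadratic Taylor terms at `z` and `-z` cancel, so the error is cubic. -/
theorem norm_log_one_add_sub_log_one_sub_le {z : ℂ} (hz : ‖z‖ ≤ 1 / 2) :
    ‖Complex.log (1 + z) - Complex.log (1 - z) - 2 * z‖ ≤ 4 / 3 * ‖z‖ ^ 3 := by
  have hlt : ‖z‖ < 1 := by linarith
  have h1 := Complex.norm_log_sub_logTaylor_le 2 hlt
  have h2 := Complex.norm_log_sub_logTaylor_le 2 (z := -z) (by rwa [norm_neg])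
  have h3 : Complex.log (1 + z) - Complex.log (1 - z) - 2 * z
      = (Complex.log (1 + z) - Complex.logTaylor (2 + 1) z)
        - (Complex.log (1 + -z) - Complex.logTaylor (2 + 1) (-z)) := by
    simp [Complex.logTaylor_succ, Complex.logTaylor_zero]
    ring_nf
  have h4 : ‖z‖ ^ (2 + 1) * (1 - ‖z‖)⁻¹ / ((2 : ℕ) + 1) ≤ 2 / 3 * ‖z‖ ^ 3 := by
    have : (1 - ‖z‖)⁻¹ ≤ 2 := by
      rw [inv_le_comm₀ (by linarith) (by norm_num)]; linarith
    have h5 : ‖z‖ ^ 3 * (1 - ‖z‖)⁻¹ ≤ ‖z‖ ^ 3 * 2 := by gcongr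
    norm_num at h5 ⊢
    linarith
  rw [norm_neg] at h2
  rw [h3]
  refine (norm_sub_le _ _).trans ?_
  linarith

theorem norm_one_div_add_one_div_le {z : ℂ} (hz : ‖z‖ ≤ 1 / 2) :
    ‖1 / (z + 1) + 1 / (z - 1) + 2 * z‖ ≤ 8 / 3 * ‖z‖ ^ 3 := by
  have h1 : z + 1 ≠ 0 := fun h => by
    rw [eq_neg_of_add_eq_zero_left h] at hz; norm_num at hz
  have h2 : z - 1 ≠ 0 := fun h => by
    rw [sub_eq_zero.1 h] at hz; norm_num at hz
  have h3 : 1 - z ^ 2 ≠ 0 := by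
    rw [show 1 - z ^ 2 = -((z + 1) * (z - 1)) by ring]
    exact neg_ne_zero.2 (mul_ne_zero h1 h2)
  have h4 : 1 / (z + 1) + 1 / (z - 1) + 2 * z = -2 * z ^ 3 / (1 - z ^ 2) := by
    field_simp
    ring
  have h5 : 3 / 4 ≤ ‖1 - z ^ 2‖ := by
    have := norm_sub_norm_le 1 (z ^ 2)
    rw [norm_one, norm_pow] at this
    nlinarith [norm_nonneg z]
  rw [h4, norm_div, norm_mul, norm_pow, div_le_iff₀ (by linarith)]
  norm_num
  nlinarith [pow_nonneg (norm_nonneg z) 3]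

/-- The logarithm of the kernel in a neighbourhood of the origin. -/
def kernelLog (m : ℤ) (t : ℝ) (z : ℂ) : ℂ :=
  2 * Complex.I * (t : ℂ) * (1 / (z + 1) + 1 / (z - 1))
    + 2 * m * (Complex.log (1 + z) - Complex.log (1 - z))

theorem kernel_eq_exp (m : ℤ) (t : ℝ) {z : ℂ} (hz : ‖z‖ ≤ 1 / 2) :
    kernel m t z = Complex.exp (kernelLog m t z) := by
  have h1 : 1 + z ≠ 0 := fun h => by
    rw [eq_neg_of_add_eq_zero_right h] at hz; norm_num at hz
  have h2 : 1 - z ≠ 0 := fun h => by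
    rw [← sub_eq_zero.1 h] at hz; norm_num at hz
  rw [kernel, kernelLog, Complex.exp_add]
  congr 1
  have h3 : (2 * m * (Complex.log (1 + z) - Complex.log (1 - z)) : ℂ)
      = ((2 * m : ℤ) : ℂ) * (Complex.log (1 + z) - Complex.log (1 - z)) := by push_cast; ring
  rw [h3, Complex.exp_int_mul, Complex.exp_sub, Complex.exp_log h1, Complex.exp_log h2,
    ← neg_sub 1 z, div_neg, (even_two_mul m).neg_zpow, add_comm z 1]

theorem norm_kernelLog_sub_le (m : ℤ) (t : ℝ) {z : ℂ} (hz : ‖z‖ ≤ 1 / 2) :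
    ‖kernelLog m t z - 4 * (m - t * Complex.I) * z‖ ≤ (16 / 3 * |t| + 8 / 3 * |(m : ℝ)|) * ‖z‖ ^ 3 := by
  have h : kernelLog m t z - 4 * (m - t * Complex.I) * z
      = 2 * Complex.I * (t : ℂ) * (1 / (z + 1) + 1 / (z - 1) + 2 * z)
        + 2 * (m : ℂ) * (Complex.log (1 + z) - Complex.log (1 - z) - 2 * z) := by
    rw [kernelLog]; ring
  rw [h]
  refine (norm_add_le _ _).trans ?_
  have h1 : ‖2 * Complex.I * (t : ℂ)‖ = 2 * |t| := by simp
  have h2 : ‖2 * (m : ℂ)‖ = 2 * |(m : ℝ)| := by simp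
  rw [norm_mul (2 * Complex.I * (t : ℂ)), norm_mul (2 * (m : ℂ)), h1, h2]
  calc _ ≤ 2 * |t| * (8 / 3 * ‖z‖ ^ 3) + 2 * |(m : ℝ)| * (4 / 3 * ‖z‖ ^ 3) := by
        gcongr
        · exact norm_one_div_add_one_div_le hz
        · exact norm_log_one_add_sub_log_one_sub_le hz
    _ = _ := by ring

theorem norm_exp_sub_exp_le {v w : ℂ} {a : ℝ} (hv : v.re ≤ a) (hw : w.re ≤ a) :
    ‖Complex.exp v - Complex.exp w‖ ≤ Real.exp a * ‖v - w‖ := by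
  refine Convex.norm_image_sub_le_of_norm_hasDerivWithin_le (𝕜 := ℂ) (s := {z : ℂ | z.re ≤ a})
    (fun z _ => (Complex.hasDerivAt_exp z).hasDerivWithinAt) (fun z hz => ?_)
    (convex_halfSpace_re_le a) hw hv
  rw [Complex.norm_exp]
  exact Real.exp_le_exp.2 hz

/-- For `s ≤ 1/2` the cubic remainder of `kernelLog` is passed through the exponential, which is
Lipschitz on a half-plane. For `s > 1/2` no cancellation is needed: both terms are at most
`exp(-2rs)` and `r s³ ≥ 1/8`, whence the constant `16`. -/
theorem norm_kernel_sub_exp_le {m : ℤ} {t r c σ s : ℝ} (hr : 1 ≤ r) (hs : 0 < s) (hs1 : s ≤ 1)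
    (hcσ : c ^ 2 + σ ^ 2 = 1) (hm : (m : ℝ) = r * c) (ht : t = r * σ) :
    ‖kernel m t (-(s * (c + σ * Complex.I))) - (Real.exp (-(4 * r * s)) : ℝ)‖
      ≤ 16 * (r * s ^ 3 * Real.exp (-(2 * r * s))) := by
  have hr0 : 0 ≤ r := by linarith
  set z : ℂ := -(s * (c + σ * Complex.I)) with hz
  have hunit : ‖(c : ℂ) + σ * Complex.I‖ = 1 := by
    rw [Complex.norm_add_mul_I, hcσ, Real.sqrt_one]
  have hnz : ‖z‖ = s := by
    rw [hz, norm_neg, norm_mul, hunit, Complex.norm_real, Real.norm_eq_abs, abs_of_pos hs, mul_one]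
  have hF : ‖kernel m t z‖ ≤ Real.exp (-(2 * r * s)) := by
    refine (norm_kernel_le hr0 hs hcσ hm ht).trans (Real.exp_le_exp.2 (neg_le_neg ?_))
    rw [le_div_iff₀ (by positivity)]
    have : s ^ 2 ≤ 1 := by nlinarith
    have h2 : 0 ≤ r * s := by positivity
    nlinarith
  have hE : Real.exp (-(4 * r * s)) ≤ Real.exp (-(2 * r * s)) :=
    Real.exp_le_exp.2 (by nlinarith [mul_nonneg hr0 hs.le])
  rcases le_or_gt s (1 / 2) with h | h
  · have hz2 : ‖z‖ ≤ 1 / 2 := by rwa [hnz]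
    -- On the cut, `z` is a negative multiple of `ζ`, so `4 conj(ζ) z` is real and negative.
    have hlead : 4 * ((m : ℂ) - t * Complex.I) * z = ((-(4 * r * s) : ℝ) : ℂ) := by
      have hmC : (m : ℂ) = r * c := by exact_mod_cast congrArg (fun x : ℝ => (x : ℂ)) hm
      have hcσC : (c : ℂ) ^ 2 + σ ^ 2 = 1 := by exact_mod_cast congrArg (fun x : ℝ => (x : ℂ)) hcσ
      rw [hmC, ht, hz]
      push_cast
      linear_combination (-4 * r * s : ℂ) * hcσC + (4 * r * s * σ ^ 2 : ℂ) * Complex.I_sq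
    have hW := norm_kernelLog_sub_le m t hz2
    rw [hlead, hnz] at hW
    rw [kernel_eq_exp m t hz2, Complex.norm_exp, Real.exp_le_exp] at hF
    rw [kernel_eq_exp m t hz2, Complex.ofReal_exp]
    refine (norm_exp_sub_exp_le hF ?_).trans ?_
    · rw [Complex.ofReal_re]
      exact Real.exp_le_exp.1 hE
    · have hc1 : |c| ≤ 1 := abs_le_of_sq_le_sq (by nlinarith [sq_nonneg σ]) zero_le_one
      have hσ1 : |σ| ≤ 1 := abs_le_of_sq_le_sq (by nlinarith [sq_nonneg c]) zero_le_one
      have h1 : |t| ≤ r := by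
        rw [ht, abs_mul, abs_of_nonneg hr0]; exact mul_le_of_le_one_right hr0 hσ1
      have h2 : |(m : ℝ)| ≤ r := by
        rw [hm, abs_mul, abs_of_nonneg hr0]; exact mul_le_of_le_one_right hr0 hc1
      calc _ ≤ Real.exp (-(2 * r * s)) * ((16 / 3 * |t| + 8 / 3 * |(m : ℝ)|) * s ^ 3) := by gcongr
        _ ≤ Real.exp (-(2 * r * s)) * (16 * r * s ^ 3) := by gcongr; linarith
        _ = _ := by ring
  · refine (norm_sub_le _ _).trans ?_
    rw [Complex.norm_real, Real.norm_eq_abs, abs_of_pos (Real.exp_pos _)]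
    have h1 : (1 / 2 : ℝ) ^ 3 ≤ s ^ 3 := by gcongr
    have h2 : 1 / 8 ≤ r * s ^ 3 := by nlinarith
    calc _ ≤ 16 * (1 / 8 * Real.exp (-(2 * r * s))) := by linarith
      _ ≤ _ := by gcongr

theorem exists_norm_kernel_sub_one_le (m : ℤ) (t : ℝ) :
    ∃ C ρ : ℝ, 0 < ρ ∧ 0 ≤ C ∧ ∀ z : ℂ, ‖z‖ ≤ ρ → ‖kernel m t z - 1‖ ≤ C * ‖z‖ := by
  have hd : DifferentiableAt ℂ (kernel m t) 0 := by
    unfold kernel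
    refine DifferentiableAt.mul (DifferentiableAt.cexp ?_) (DifferentiableAt.zpow ?_ (by norm_num))
    · refine DifferentiableAt.const_mul (DifferentiableAt.add ?_ ?_) _ <;>
        exact DifferentiableAt.div (by fun_prop) (by fun_prop) (by norm_num)
    · exact DifferentiableAt.div (by fun_prop) (by fun_prop) (by norm_num)
  have h0 : kernel m t 0 = 1 := by
    simp [kernel, (even_two_mul m).neg_zpow]
  have hO := hd.hasFDerivAt.isBigO_sub
  obtain ⟨C, hC, hb⟩ := hO.exists_pos
  rw [Asymptotics.isBigOWith_iff, Metric.eventually_nhds_iff] at hb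
  obtain ⟨ρ, hρ, hb⟩ := hb
  refine ⟨C, ρ / 2, by positivity, hC.le, fun z hz => ?_⟩
  have := hb (y := z) (by rw [dist_zero_right]; linarith)
  rwa [h0, sub_zero] at this

/-! ### Rectangle integrals and logarithmic coordinates -/

/-- The integral of `f` along the counterclockwise boundary of the rectangle `[a, b] × [c, d]`. -/
def rectIntegral (f : ℂ → ℂ) (a b c d : ℝ) : ℂ :=
  (∫ x in a..b, f (x + c * Complex.I)) - (∫ x in a..b, f (x + d * Complex.I))
    + Complex.I * (∫ y in c..d, f (b + y * Complex.I))
    - Complex.I * ∫ y in c..d, f (a + y * Complex.I)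

theorem rectIntegral_eq_zero {f : ℂ → ℂ} {a b c d : ℝ} (hab : a ≤ b) (hcd : c ≤ d)
    (hf : ∀ x ∈ Icc a b, ∀ y ∈ Icc c d, DifferentiableAt ℂ f (x + y * Complex.I)) :
    rectIntegral f a b c d = 0 := by
  have h := Complex.integral_boundary_rect_eq_zero_of_differentiableOn f
    (a + c * Complex.I) (b + d * Complex.I) (fun w hw => ?_)
  · simpa [rectIntegral] using h
  · rw [Complex.mem_reProdIm] at hw
    simp only [Complex.add_re, Complex.ofReal_re, Complex.mul_re, Complex.I_re, mul_zero,
      Complex.ofReal_im, Complex.I_im, sub_self, add_zero, Complex.add_im, Complex.mul_im, mul_one,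
      zero_add, uIcc_of_le hab, uIcc_of_le hcd] at hw
    have := hf _ hw.1 _ hw.2
    rw [Complex.re_add_im] at this
    exact this.differentiableWithinAt

theorem rectIntegral_add_horizontal {f : ℂ → ℂ} {a b e c d : ℝ}
    (h1 : IntervalIntegrable (fun x : ℝ => f (x + c * Complex.I)) volume a b)
    (h2 : IntervalIntegrable (fun x : ℝ => f (x + c * Complex.I)) volume b e)
    (h3 : IntervalIntegrable (fun x : ℝ => f (x + d * Complex.I)) volume a b)
    (h4 : IntervalIntegrable (fun x : ℝ => f (x + d * Complex.I)) volume b e) :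
    rectIntegral f a b c d + rectIntegral f b e c d = rectIntegral f a e c d := by
  simp only [rectIntegral, ← intervalIntegral.integral_add_adjacent_intervals h1 h2,
    ← intervalIntegral.integral_add_adjacent_intervals h3 h4]
  ring

theorem rectIntegral_add_vertical {f : ℂ → ℂ} {a b c d e : ℝ}
    (h1 : IntervalIntegrable (fun y : ℝ => f (a + y * Complex.I)) volume c d)
    (h2 : IntervalIntegrable (fun y : ℝ => f (a + y * Complex.I)) volume d e)
    (h3 : IntervalIntegrable (fun y : ℝ => f (b + y * Complex.I)) volume c d)
    (h4 : IntervalIntegrable (fun y : ℝ => f (b + y * Complex.I)) volume d e) :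
    rectIntegral f a b c d + rectIntegral f a b d e = rectIntegral f a b c e := by
  simp only [rectIntegral, ← intervalIntegral.integral_add_adjacent_intervals h1 h2,
    ← intervalIntegral.integral_add_adjacent_intervals h3 h4]
  ring

theorem intervalIntegrable_horizontal {f : ℂ → ℂ} {a b c : ℝ} (hab : a ≤ b)
    (hf : ∀ x ∈ Icc a b, DifferentiableAt ℂ f (x + c * Complex.I)) :
    IntervalIntegrable (fun x : ℝ => f (x + c * Complex.I)) volume a b := by
  refine ContinuousOn.intervalIntegrable_of_Icc hab fun x hx => ContinuousAt.continuousWithinAt ?_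
  exact ContinuousAt.comp (f := fun x : ℝ => (x + c * Complex.I : ℂ)) (hf x hx).continuousAt
    (by fun_prop)

theorem intervalIntegrable_vertical {f : ℂ → ℂ} {a c d : ℝ} (hcd : c ≤ d)
    (hf : ∀ y ∈ Icc c d, DifferentiableAt ℂ f (a + y * Complex.I)) :
    IntervalIntegrable (fun y : ℝ => f (a + y * Complex.I)) volume c d := by
  refine ContinuousOn.intervalIntegrable_of_Icc hcd fun y hy => ContinuousAt.continuousWithinAt ?_
  exact ContinuousAt.comp (f := fun y : ℝ => (a + y * Complex.I : ℂ)) (hf y hy).continuousAt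
    (by fun_prop)

/-- Cauchy's theorem for the region between two nested rectangles. -/
theorem rectIntegral_eq_of_nested {f : ℂ → ℂ} {a b c d a' b' c' d' : ℝ}
    (ha : a' ≤ a) (hab : a ≤ b) (hb : b ≤ b') (hc : c' ≤ c) (hcd : c ≤ d) (hd : d ≤ d')
    (hf : ∀ x ∈ Icc a' b', ∀ y ∈ Icc c' d', (x ≤ a ∨ b ≤ x ∨ y ≤ c ∨ d ≤ y) →
      DifferentiableAt ℂ f (x + y * Complex.I)) :
    rectIntegral f a b c d = rectIntegral f a' b' c' d' := by
  -- The frame splits into two side strips of full height and the strips below and above the inner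
  -- rectangle.
  have hleft : rectIntegral f a' a c' d' = 0 :=
    rectIntegral_eq_zero ha (by linarith) fun x hx y hy =>
      hf x ⟨hx.1, by linarith [hx.2]⟩ y hy (Or.inl hx.2)
  have hright : rectIntegral f b b' c' d' = 0 :=
    rectIntegral_eq_zero hb (by linarith) fun x hx y hy =>
      hf x ⟨by linarith [hx.1], hx.2⟩ y hy (Or.inr (Or.inl hx.1))
  have hbot : rectIntegral f a b c' c = 0 :=
    rectIntegral_eq_zero hab hc fun x hx y hy =>
      hf x ⟨by linarith [hx.1], by linarith [hx.2]⟩ y ⟨hy.1, by linarith [hy.2]⟩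
        (Or.inr (Or.inr (Or.inl hy.2)))
  have htop : rectIntegral f a b d d' = 0 :=
    rectIntegral_eq_zero hab hd fun x hx y hy =>
      hf x ⟨by linarith [hx.1], by linarith [hx.2]⟩ y ⟨by linarith [hy.1], hy.2⟩
        (Or.inr (Or.inr (Or.inr hy.1)))
  have hH : ∀ p q y : ℝ, p ≤ q → a' ≤ p → q ≤ b' → y ∈ Icc c' d' → (y ≤ c ∨ d ≤ y) →
      IntervalIntegrable (fun x : ℝ => f (x + y * Complex.I)) volume p q := by
    intro p q y hpq hp hq hy hy'
    exact intervalIntegrable_horizontal hpq fun x hx =>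
      hf x ⟨hp.trans hx.1, hx.2.trans hq⟩ y hy (Or.inr (Or.inr hy'))
  have hV : ∀ p q x : ℝ, p ≤ q → c' ≤ p → q ≤ d' → x ∈ Icc a' b' → (x ≤ a ∨ b ≤ x) →
      IntervalIntegrable (fun y : ℝ => f (x + y * Complex.I)) volume p q := by
    intro p q x hpq hp hq hx hx'
    exact intervalIntegrable_vertical hpq fun y hy =>
      hf x hx y ⟨hp.trans hy.1, hy.2.trans hq⟩ (by tauto)
  have hyc : c' ∈ Icc c' d' := ⟨le_rfl, by linarith⟩
  have hyd : d' ∈ Icc c' d' := ⟨by linarith, le_rfl⟩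
  have hxa : a ∈ Icc a' b' := ⟨ha, by linarith⟩
  have hxb : b ∈ Icc a' b' := ⟨by linarith, hb⟩
  have e1 := rectIntegral_add_horizontal (hH a' a c' ha le_rfl (by linarith) hyc (Or.inl hc))
    (hH a b c' hab ha hb hyc (Or.inl hc)) (hH a' a d' ha le_rfl (by linarith) hyd (Or.inr hd))
    (hH a b d' hab ha hb hyd (Or.inr hd))
  have e2 := rectIntegral_add_horizontal
    (hH a' b c' (by linarith) le_rfl hb hyc (Or.inl hc))
    (hH b b' c' hb (by linarith) le_rfl hyc (Or.inl hc))
    (hH a' b d' (by linarith) le_rfl hb hyd (Or.inr hd))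
    (hH b b' d' hb (by linarith) le_rfl hyd (Or.inr hd))
  have e3 := rectIntegral_add_vertical (hV c' c a hc le_rfl (by linarith) hxa (Or.inl le_rfl))
    (hV c d a hcd hc hd hxa (Or.inl le_rfl)) (hV c' c b hc le_rfl (by linarith) hxb (Or.inr le_rfl))
    (hV c d b hcd hc hd hxb (Or.inr le_rfl))
  have e4 := rectIntegral_add_vertical
    (hV c' d a (by linarith) le_rfl hd hxa (Or.inl le_rfl))
    (hV d d' a hd (by linarith) le_rfl hxa (Or.inl le_rfl))
    (hV c' d b (by linarith) le_rfl hd hxb (Or.inr le_rfl))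
    (hV d d' b hd (by linarith) le_rfl hxb (Or.inr le_rfl))
  rw [← e2, ← e1, ← e4, ← e3, hleft, hright, hbot, htop]
  ring

theorem sectorIntegral_eq_rectIntegral (h : ℂ → ℂ) {p q : ℝ} (hpq : p ≤ q) (a b : ℝ) :
    sectorIntegral h (Real.exp p) (Real.exp q) a b
      = rectIntegral (fun w => h (Complex.exp w) * Complex.exp w) p q a b := by
  have harc : ∀ x, arcIntegral h (Real.exp x) a b
      = Complex.I * ∫ y in a..b, h (Complex.exp (x + y * Complex.I))
          * Complex.exp (x + y * Complex.I) := by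
    intro x
    rw [arcIntegral, ← intervalIntegral.integral_const_mul]
    refine intervalIntegral.integral_congr fun y _ => ?_
    simp only [Complex.exp_add, Complex.ofReal_exp]
    ring
  have hrad : ∀ y, radialIntegral h y (Real.exp p) (Real.exp q)
      = ∫ x in p..q, h (Complex.exp (x + y * Complex.I)) * Complex.exp (x + y * Complex.I) := by
    intro y
    rw [radialIntegral, integral_exp_substitution _ hpq]
    refine intervalIntegral.integral_congr fun x _ => ?_
    simp only [Complex.exp_add, Complex.ofReal_exp]
    ring
  rw [sectorIntegral, rectIntegral, harc, harc, hrad, hrad]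
  ring

theorem logBranch_exp {θ : ℝ} {w : ℂ} (h : |w.im - θ| < Real.pi) :
    logBranch θ (Complex.exp w) = w := by
  obtain ⟨h1, h2⟩ := abs_lt.1 h
  rw [logBranch, ← Complex.exp_add, Complex.log_exp]
  · ring
  · simpa [← sub_eq_add_neg] using h1
  · simpa [← sub_eq_add_neg] using h2.le

theorem rectIntegral_congr {f g : ℂ → ℂ} {a b c d : ℝ} (hcd : c ≤ d)
    (h : ∀ x y : ℝ, y ∈ Icc c d → f (x + y * Complex.I) = g (x + y * Complex.I)) :
    rectIntegral f a b c d = rectIntegral g a b c d := by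
  have hv : ∀ x : ℝ, ∫ y in c..d, f (x + y * Complex.I) = ∫ y in c..d, g (x + y * Complex.I) :=
    fun x => intervalIntegral.integral_congr fun y hy => h x y (by rwa [uIcc_of_le hcd] at hy)
  simp only [rectIntegral, hv, h _ c (left_mem_Icc.2 hcd), h _ d (right_mem_Icc.2 hcd)]

/-! ### Holomorphy outside the contour and its extension to the cut -/

theorem gap_bounds (m : ℤ) (t : ℝ) : 0 < gap m t ∧ gap m t ≤ Real.pi / 2 := by
  have hpi := Real.pi_pos
  rw [gap]
  split_ifs with h
  · exact ⟨by positivity, le_rfl⟩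
  · have him : (point 1 m t).im = t := by simp [point]
    have h0 : angle m t ≠ 0 := by
      intro h0
      rw [angle, Complex.arg_eq_zero_iff, him] at h0
      exact h h0.2
    have h1 : angle m t ≠ Real.pi := by
      intro h1
      rw [angle, Complex.arg_eq_pi_iff, him] at h1
      exact h h1.2
    have h2 : |angle m t| < Real.pi := abs_lt.2
      ⟨Complex.neg_pi_lt_arg _, lt_of_le_of_ne (Complex.arg_le_pi _) h1⟩
    have h3 : 0 < |angle m t| := abs_pos.2 h0
    refine ⟨by positivity [lt_min h3 (sub_pos.2 h2)], ?_⟩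
    linarith [min_le_left |angle m t| (Real.pi - |angle m t|)]

theorem differentiableAt_kernel (m : ℤ) (t : ℝ) {z : ℂ} (h1 : z ≠ 1) (h2 : z ≠ -1) :
    DifferentiableAt ℂ (kernel m t) z := by
  have h1' : z - 1 ≠ 0 := sub_ne_zero.2 h1
  have h2' : z + 1 ≠ 0 := fun h => h2 (eq_neg_of_add_eq_zero_left h)
  unfold kernel
  refine DifferentiableAt.mul (DifferentiableAt.cexp ?_)
    (DifferentiableAt.zpow ?_ (Or.inl (div_ne_zero h2' h1')))
  · refine DifferentiableAt.const_mul (DifferentiableAt.add ?_ ?_) _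
    · exact DifferentiableAt.div (by fun_prop) (by fun_prop) h2'
    · exact DifferentiableAt.div (by fun_prop) (by fun_prop) h1'
  · exact DifferentiableAt.div (by fun_prop) (by fun_prop) h1'

theorem differentiableAt_kernel_of_pos {m : ℤ} (hm : 0 < m) {z : ℂ} (h1 : z ≠ 1) :
    DifferentiableAt ℂ (kernel m 0) z := by
  have h1' : z - 1 ≠ 0 := sub_ne_zero.2 h1
  have : kernel m 0 = fun z => ((z + 1) / (z - 1)) ^ (2 * m : ℤ) := by
    funext z; simp [kernel]
  rw [this]
  exact DifferentiableAt.zpow (DifferentiableAt.div (by fun_prop) (by fun_prop) h1')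
    (Or.inr (by omega))

theorem differentiableAt_kernel_of_neg {m : ℤ} (hm : m < 0) {z : ℂ} (h1 : z ≠ -1) :
    DifferentiableAt ℂ (kernel m 0) z := by
  have h1' : z + 1 ≠ 0 := fun h => h1 (eq_neg_of_add_eq_zero_left h)
  have : kernel m 0 = fun z => ((z - 1) / (z + 1)) ^ (2 * (-m) : ℤ) := by
    funext z
    rw [mul_neg, zpow_neg, ← inv_zpow, inv_div]
    simp [kernel]
  rw [this]
  exact DifferentiableAt.zpow (DifferentiableAt.div (by fun_prop) (by fun_prop) h1')
    (Or.inr (by omega))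

/-- Away from the inner rectangle, the kernel is holomorphic in logarithmic coordinates. -/
theorem differentiableAt_kernel_exp {m : ℤ} {t : ℝ} (hne : t ≠ 0 ∨ m ≠ 0) {w : ℂ}
    (hw : |w.im - angle m t| ≤ Real.pi)
    (hw' : w.re ≠ 0 ∨ Real.pi - gap m t ≤ |w.im - angle m t|) :
    DifferentiableAt ℂ (kernel m t) (Complex.exp w) := by
  have hpi := Real.pi_pos
  have hone : Complex.exp w = 1 → w.re = 0 ∧ ∃ n : ℤ, w.im = n * (2 * Real.pi) := by
    intro h
    obtain ⟨n, hn⟩ := Complex.exp_eq_one_iff.1 h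
    exact ⟨by simp [hn], n, by simp [hn]⟩
  have hneg : Complex.exp w = -1 → w.re = 0 ∧ ∃ n : ℤ, w.im = n * (2 * Real.pi) + Real.pi := by
    intro h
    have h' : Complex.exp (w - Real.pi * Complex.I) = 1 := by
      rw [Complex.exp_sub, h, Complex.exp_pi_mul_I, div_self (by norm_num)]
    obtain ⟨n, hn⟩ := Complex.exp_eq_one_iff.1 h'
    have hn' := sub_eq_iff_eq_add.1 hn
    exact ⟨by simp [hn'], n, by simp [hn']⟩
  obtain ⟨hl, hr⟩ := abs_le.1 hw
  have hint : ∀ n : ℤ, (-1 : ℝ) < n → (n : ℝ) < 1 → n = 0 := by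
    intro n h1 h2
    have h1' : -1 < n := by exact_mod_cast h1
    have h2' : n < 1 := by exact_mod_cast h2
    omega
  rcases eq_or_ne t 0 with rfl | ht
  · have hm : m ≠ 0 := by simpa using hne
    have hg : gap m 0 = Real.pi / 2 := by simp [gap]
    have hpt : point 1 m 0 = ((m : ℝ) : ℂ) := by simp [point]
    rw [hg] at hw'
    rcases hm.lt_or_gt with hm | hm
    · have hθ : angle m 0 = Real.pi := by
        rw [angle, hpt, Complex.arg_ofReal_of_neg (by exact_mod_cast hm)]
      rw [hθ] at hl hr hw'
      refine differentiableAt_kernel_of_neg hm fun h => ?_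
      obtain ⟨hre, n, hn⟩ := hneg h
      have hn0 : n = 0 := hint n (by nlinarith) (by nlinarith)
      rcases hw' with h' | h'
      · exact h' hre
      · rw [hn, hn0] at h'
        simp at h'
        linarith
    · have hθ : angle m 0 = 0 := by
        rw [angle, hpt, Complex.arg_ofReal_of_nonneg (by exact_mod_cast hm.le)]
      rw [hθ] at hl hr hw'
      refine differentiableAt_kernel_of_pos hm fun h => ?_
      obtain ⟨hre, n, hn⟩ := hone h
      have hn0 : n = 0 := hint n (by nlinarith) (by nlinarith)
      rcases hw' with h' | h'
      · exact h' hre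
      · rw [hn, hn0] at h'
        simp at h'
        linarith
  · have him : (point 1 m t).im = t := by simp [point]
    set θ := angle m t with hθ
    have h0 : θ ≠ 0 := by
      intro h0
      rw [hθ, angle, Complex.arg_eq_zero_iff, him] at h0
      exact ht h0.2
    have h1 : θ < Real.pi := by
      refine lt_of_le_of_ne (Complex.arg_le_pi _) fun h1 => ?_
      rw [hθ, angle, Complex.arg_eq_pi_iff, him] at h1
      exact ht h1.2
    have h2 : -Real.pi < θ := Complex.neg_pi_lt_arg _
    have hgap : gap m t = min |θ| (Real.pi - |θ|) / 2 := by simp [gap, ht, hθ]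
    have hg1 : gap m t ≤ |θ| / 2 := by rw [hgap]; gcongr; exact min_le_left _ _
    have hg2 : gap m t ≤ (Real.pi - |θ|) / 2 := by rw [hgap]; gcongr; exact min_le_right _ _
    -- The points `±1` lift to `iπℤ`. Only two lifts lie within `π` of `θ`, at distances `|θ|` and
    -- `π - |θ|`, both less than `π - gap m t`.
    have key : w.re = 0 → ∀ k : ℤ, w.im ≠ k * Real.pi := by
      intro hre k hk
      have hw'' := hw'.resolve_left (not_not.2 hre)
      rcases h0.lt_or_gt with hneg | hpos
      · rw [abs_of_neg hneg] at hg1 hg2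
        have hk1 : (-2 : ℝ) < k := by nlinarith
        have hk2 : (k : ℝ) < 1 := by nlinarith
        have hk1' : -2 < k := by exact_mod_cast hk1
        have hk2' : k < 1 := by exact_mod_cast hk2
        obtain rfl | rfl : k = -1 ∨ k = 0 := by omega
        · push_cast at hk
          rw [hk, abs_of_nonpos (by linarith)] at hw''
          linarith
        · push_cast at hk
          rw [hk, abs_of_nonneg (by linarith)] at hw''
          linarith
      · rw [abs_of_pos hpos] at hg1 hg2
        have hk1 : (-1 : ℝ) < k := by nlinarith
        have hk2 : (k : ℝ) < 2 := by nlinarith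
        have hk1' : -1 < k := by exact_mod_cast hk1
        have hk2' : k < 2 := by exact_mod_cast hk2
        obtain rfl | rfl : k = 0 ∨ k = 1 := by omega
        · push_cast at hk
          rw [hk, abs_of_nonpos (by linarith)] at hw''
          linarith
        · push_cast at hk
          rw [hk, abs_of_nonneg (by linarith)] at hw''
          linarith
    refine differentiableAt_kernel m t (fun h => ?_) (fun h => ?_)
    · obtain ⟨hre, n, hn⟩ := hone h
      exact key hre (2 * n) (by rw [hn]; push_cast; ring)
    · obtain ⟨hre, n, hn⟩ := hneg h
      exact key hre (2 * n + 1) (by rw [hn]; push_cast; ring)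

/-- The integrand of the Green's function in logarithmic coordinates. -/
def logIntegrand (m : ℤ) (t : ℝ) (w : ℂ) : ℂ := kernel m t (Complex.exp w) * w

theorem differentiableAt_logIntegrand {m : ℤ} {t : ℝ} (hne : t ≠ 0 ∨ m ≠ 0) {x y : ℝ}
    (hy : |y - angle m t| ≤ Real.pi) (hxy : x ≠ 0 ∨ Real.pi - gap m t ≤ |y - angle m t|) :
    DifferentiableAt ℂ (logIntegrand m t) (x + y * Complex.I) := by
  have h := differentiableAt_kernel_exp (w := x + y * Complex.I) hne (by simpa using hy)
    (by simpa using hxy)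
  exact (h.comp _ Complex.differentiableAt_exp).mul differentiableAt_id

/-- The radii `1/2` and `2` become `∓ log 2`. Since `w` has no branch cut, Cauchy's theorem moves
the sides right onto the two lips of the cut. -/
theorem green_eq_rectIntegral {m : ℤ} {t : ℝ} (hne : t ≠ 0 ∨ m ≠ 0) {L : ℝ} (hL : Real.log 2 ≤ L) :
    8 * (Real.pi : ℂ) ^ 2 * Complex.I * green m t
      = rectIntegral (logIntegrand m t) (-L) L (angle m t - Real.pi) (angle m t + Real.pi) := by
  have hpi := Real.pi_pos
  have hlog : 0 < Real.log 2 := Real.log_pos (by norm_num)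
  obtain ⟨hg0, hg1⟩ := gap_bounds m t
  have hc : 8 * (Real.pi : ℂ) ^ 2 * Complex.I ≠ 0 := by
    simp [Complex.ofReal_ne_zero.2 hpi.ne']
  have hhalf : (1 / 2 : ℝ) = Real.exp (-Real.log 2) := by
    rw [Real.exp_neg, Real.exp_log (by norm_num), one_div]
  have htwo : Real.exp (Real.log 2) = 2 := Real.exp_log (by norm_num)
  have hsec := sectorIntegral_eq_rectIntegral
    (fun z => discreteExp m t z * logBranch (angle m t) z) (p := -Real.log 2) (q := Real.log 2)
    (by linarith) (angle m t - Real.pi + gap m t) (angle m t + Real.pi - gap m t)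
  rw [htwo, ← hhalf] at hsec
  rw [green, ← mul_assoc, mul_one_div_cancel hc, one_mul, hsec]
  rw [rectIntegral_congr (g := logIntegrand m t) (by linarith)]
  · refine rectIntegral_eq_of_nested (by linarith) (by linarith) hL (by linarith) (by linarith)
      (by linarith) fun x _ y hy hxy => differentiableAt_logIntegrand hne ?_ ?_
    · exact abs_le.2 ⟨by linarith [hy.1], by linarith [hy.2]⟩
    · rcases hxy with h | h | h | h
      · exact Or.inl (by linarith : x < 0).ne
      · exact Or.inl (by linarith : 0 < x).ne'
      · right; rw [abs_of_nonpos (by linarith)]; linarith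
      · right; rw [abs_of_nonneg (by linarith)]; linarith
  · intro x y hy
    have : |(x + y * Complex.I : ℂ).im - angle m t| < Real.pi := by
      simpa using abs_lt.2 ⟨by linarith [hy.1], by linarith [hy.2]⟩
    simp only [logIntegrand]
    rw [logBranch_exp this, mul_right_comm, discreteExp_mul_self m t (Complex.exp_ne_zero _)]

/-- The exponential convergence `f → 1` beats the linear growth of the factor `w`. The sign `ε`
serves both vertical sides. -/
theorem tendsto_vertical_integral {f : ℂ → ℂ} {C ρ : ℝ} (hρ : 0 < ρ) (hC : 0 ≤ C)
    (ε : ℝ) (hε : |ε| = 1) (hf : ∀ x y : ℝ, Real.exp (-x) ≤ ρ →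
      ‖f ((ε * x : ℝ) + y * Complex.I) - 1‖ ≤ C * Real.exp (-x)) {c d : ℝ} (hcd : c ≤ d)
    (hint : ∀ᶠ x : ℝ in atTop, IntervalIntegrable
      (fun y : ℝ => f ((ε * x : ℝ) + y * Complex.I) * ((ε * x : ℝ) + y * Complex.I)) volume c d) :
    Tendsto (fun x : ℝ =>
      (∫ y in c..d, f ((ε * x : ℝ) + y * Complex.I) * ((ε * x : ℝ) + y * Complex.I))
        - ∫ y in c..d, ((ε * x : ℝ) + y * Complex.I : ℂ)) atTop (𝓝 0) := by
  have hexp : Tendsto (fun x : ℝ => Real.exp (-x)) atTop (𝓝 0) :=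
    Real.tendsto_exp_neg_atTop_nhds_zero
  have hxexp : Tendsto (fun x : ℝ => x * Real.exp (-x)) atTop (𝓝 0) := by
    simpa using Real.tendsto_pow_mul_exp_neg_atTop_nhds_zero 1
  have hlim : Tendsto (fun x : ℝ => C * (x * Real.exp (-x) + (|c| + |d|) * Real.exp (-x)) * |d - c|)
      atTop (𝓝 0) := by
    simpa using (((hxexp.add (hexp.const_mul (|c| + |d|))).const_mul C).mul_const |d - c|)
  refine squeeze_zero_norm' ?_ hlim
  filter_upwards [hint, eventually_ge_atTop 0, hexp.eventually (ge_mem_nhds hρ)] with x hx hx0 hxρ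
  rw [← intervalIntegral.integral_sub hx (Continuous.intervalIntegrable (by fun_prop) _ _)]
  refine intervalIntegral.norm_integral_le_of_norm_le_const fun y hy => ?_
  rw [uIoc_of_le hcd] at hy
  have h1 : f ((ε * x : ℝ) + y * Complex.I) * ((ε * x : ℝ) + y * Complex.I)
      - ((ε * x : ℝ) + y * Complex.I)
      = (f ((ε * x : ℝ) + y * Complex.I) - 1) * ((ε * x : ℝ) + y * Complex.I) := by ring
  have h2 : ‖((ε * x : ℝ) + y * Complex.I : ℂ)‖ ≤ x + (|c| + |d|) := by
    refine (norm_add_le _ _).trans ?_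
    rw [norm_mul (y : ℂ), Complex.norm_I, mul_one, Complex.norm_real, Complex.norm_real,
      Real.norm_eq_abs, Real.norm_eq_abs, abs_mul, hε, one_mul, abs_of_nonneg hx0]
    have : |y| ≤ |c| + |d| := abs_le.2
      ⟨by linarith [neg_abs_le c, abs_nonneg d, hy.1], by linarith [le_abs_self d, abs_nonneg c, hy.2]⟩
    linarith
  rw [h1, norm_mul]
  calc _ ≤ C * Real.exp (-x) * (x + (|c| + |d|)) :=
        mul_le_mul (hf x y hxρ) h2 (norm_nonneg _) (by positivity)
    _ = _ := by ring

/-! ### Reduction to an integral along the cut -/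

/-- The kernel along the branch cut, in the logarithmic coordinate. -/
def cutKernel (m : ℤ) (t x : ℝ) : ℂ :=
  kernel m t (-(Real.exp x * (Real.cos (angle m t) + Real.sin (angle m t) * Complex.I)))

theorem kernel_exp_eq_cutKernel (m : ℤ) (t x : ℝ) :
    kernel m t (Complex.exp (x + (angle m t - Real.pi : ℝ) * Complex.I)) = cutKernel m t x
      ∧ kernel m t (Complex.exp (x + (angle m t + Real.pi : ℝ) * Complex.I)) = cutKernel m t x := by
  have h : Complex.exp (angle m t * Complex.I)
      = Real.cos (angle m t) + Real.sin (angle m t) * Complex.I := by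
    rw [Complex.exp_mul_I, Complex.ofReal_cos, Complex.ofReal_sin]
  constructor
  · rw [cutKernel, ← h, Complex.exp_add]
    push_cast
    rw [sub_mul, Complex.exp_sub, Complex.exp_pi_mul_I, div_neg, div_one, mul_neg]
  · rw [cutKernel, ← h, Complex.exp_add]
    push_cast
    rw [add_mul, Complex.exp_add, Complex.exp_pi_mul_I, mul_neg, mul_one, mul_neg]

theorem continuous_cutKernel {m : ℤ} {t : ℝ} (hne : t ≠ 0 ∨ m ≠ 0) :
    Continuous (cutKernel m t) := by
  refine continuous_iff_continuousAt.2 fun x => ?_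
  have hg := (gap_bounds m t).1
  have hd : DifferentiableAt ℂ (fun w => kernel m t (Complex.exp w))
      (x + (angle m t + Real.pi : ℝ) * Complex.I) := by
    refine (differentiableAt_kernel_exp hne ?_ (Or.inr ?_)).comp _ Complex.differentiableAt_exp
    · simp [abs_of_pos Real.pi_pos]
    · simp [abs_of_pos Real.pi_pos, hg.le]
  have := ContinuousAt.comp (f := fun x : ℝ => (x + (angle m t + Real.pi : ℝ) * Complex.I : ℂ))
    hd.continuousAt (by fun_prop)
  refine this.congr (Eventually.of_forall fun y => ?_)
  exact (kernel_exp_eq_cutKernel m t y).2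

theorem exists_norm_kernel_exp_sub_one_le (m : ℤ) (t : ℝ) :
    ∃ C ρ : ℝ, 0 < ρ ∧ 0 ≤ C ∧ ∀ ε : ℝ, (ε = 1 ∨ ε = -1) → ∀ x y : ℝ, Real.exp (-x) ≤ ρ →
      ‖kernel m t (Complex.exp ((ε * x : ℝ) + y * Complex.I)) - 1‖ ≤ C * Real.exp (-x) := by
  obtain ⟨C, ρ, hρ, hC, h⟩ := exists_norm_kernel_sub_one_le m t
  obtain ⟨C', ρ', hρ', hC', h'⟩ := exists_norm_kernel_sub_one_le m (-t)
  refine ⟨max C C', min (min ρ ρ') (1 / 2), by positivity, le_max_of_le_left hC, ?_⟩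
  intro ε hε x y hx
  have hxρ : Real.exp (-x) ≤ ρ := hx.trans ((min_le_left _ _).trans (min_le_left _ _))
  have hxρ' : Real.exp (-x) ≤ ρ' := hx.trans ((min_le_left _ _).trans (min_le_right _ _))
  have hx2 : Real.exp (-x) ≤ 1 / 2 := hx.trans (min_le_right _ _)
  rcases hε with rfl | rfl
  · set z := Complex.exp (-((1 * x : ℝ) + y * Complex.I)) with hz
    have hn : ‖z‖ = Real.exp (-x) := by simp [hz, Complex.norm_exp]
    have h1 : z ≠ 1 := fun h => by rw [h, norm_one] at hn; linarith
    have h2 : z ≠ -1 := fun h => by rw [h, norm_neg, norm_one] at hn; linarith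
    have h3 : Complex.exp ((1 * x : ℝ) + y * Complex.I) = z⁻¹ := by rw [hz, Complex.exp_neg, inv_inv]
    rw [h3, kernel_inv m t (Complex.exp_ne_zero _) h1 h2]
    refine (h' z (by rwa [hn])).trans ?_
    rw [hn]
    gcongr
    exact le_max_right _ _
  · have hn : ‖Complex.exp ((-1 * x : ℝ) + y * Complex.I)‖ = Real.exp (-x) := by
      simp [Complex.norm_exp]
    refine (h _ (by rwa [hn])).trans ?_
    rw [hn]
    gcongr
    exact le_max_left _ _

/-- The Green's function as a regularized integral of the kernel along the branch cut. -/
theorem tendsto_sub_integral_cutKernel {m : ℤ} {t : ℝ} (hne : t ≠ 0 ∨ m ≠ 0) :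
    Tendsto (fun L : ℝ => (2 * L : ℂ) - ∫ x in (-L)..L, cutKernel m t x) atTop
      (𝓝 (4 * Real.pi * green m t)) := by
  have hpi := Real.pi_pos
  have hpiC : (Real.pi : ℂ) ≠ 0 := Complex.ofReal_ne_zero.2 hpi.ne'
  have hg := (gap_bounds m t).1
  set θ := angle m t with hθ
  have hcd : θ - Real.pi ≤ θ + Real.pi := by linarith
  obtain ⟨C, ρ, hρ, hC, hb⟩ := exists_norm_kernel_exp_sub_one_le m t
  have hlim : ∀ ε : ℝ, (ε = 1 ∨ ε = -1) → Tendsto (fun x : ℝ =>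
      (∫ y in (θ - Real.pi)..(θ + Real.pi), logIntegrand m t ((ε * x : ℝ) + y * Complex.I))
        - ∫ y in (θ - Real.pi)..(θ + Real.pi), ((ε * x : ℝ) + y * Complex.I : ℂ)) atTop (𝓝 0) := by
    intro ε hε
    have hε1 : |ε| = 1 := by rcases hε with rfl | rfl <;> simp
    refine tendsto_vertical_integral (f := fun w => kernel m t (Complex.exp w)) hρ hC ε hε1
      (hb ε hε) hcd ?_
    filter_upwards [eventually_gt_atTop 0] with x hx
    refine intervalIntegrable_vertical (f := logIntegrand m t) hcd fun y hy => ?_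
    refine differentiableAt_logIntegrand hne ?_ (Or.inl ?_)
    · exact abs_le.2 ⟨by linarith [hy.1], by linarith [hy.2]⟩
    · rcases hε with rfl | rfl <;> simp [hx.ne']
  have h1 := (hlim 1 (Or.inl rfl)).sub (hlim (-1) (Or.inr rfl))
  have h2 := (h1.mul_const (1 / (2 * Real.pi : ℂ))).const_sub (4 * Real.pi * green m t)
  simp only [sub_zero, zero_mul] at h2
  refine h2.congr' ?_
  filter_upwards [eventually_ge_atTop (Real.log 2)] with L hL
  have hL0 : 0 < L := (Real.log_pos (by norm_num)).trans_le hL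
  have hG := green_eq_rectIntegral hne hL
  rw [← hθ, rectIntegral] at hG
  -- In the difference of the sides `x = ±L` the second term cancels and `4πL` remains, the source
  -- of `2L`.
  have hlin : ∀ x : ℝ, ∫ y in (θ - Real.pi)..(θ + Real.pi), ((x : ℂ) + y * Complex.I)
      = 2 * Real.pi * x + ∫ y in (θ - Real.pi)..(θ + Real.pi), (y : ℂ) * Complex.I := by
    intro x
    rw [intervalIntegral.integral_add (Continuous.intervalIntegrable (by fun_prop) _ _)
      (Continuous.intervalIntegrable (by fun_prop) _ _), intervalIntegral.integral_const]
    simp only [Complex.real_smul]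
    push_cast
    ring
  -- The kernel agrees on both lips, so only the jump `2πi` of `w` survives.
  have hhor : (∫ x in (-L)..L, logIntegrand m t (x + (θ - Real.pi : ℝ) * Complex.I))
      - (∫ x in (-L)..L, logIntegrand m t (x + (θ + Real.pi : ℝ) * Complex.I))
      = -(2 * Real.pi * Complex.I) * ∫ x in (-L)..L, cutKernel m t x := by
    rw [← intervalIntegral.integral_sub, ← intervalIntegral.integral_const_mul]
    · refine intervalIntegral.integral_congr fun x _ => ?_
      obtain ⟨e1, e2⟩ := kernel_exp_eq_cutKernel m t x
      simp only [logIntegrand]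
      rw [e1, e2]
      push_cast
      ring
    · refine intervalIntegrable_horizontal (by linarith) fun x _ =>
        differentiableAt_logIntegrand hne ?_ (Or.inr ?_)
      · rw [← hθ, sub_sub_cancel_left, abs_neg, abs_of_pos hpi]
      · rw [← hθ, sub_sub_cancel_left, abs_neg, abs_of_pos hpi]; linarith
    · refine intervalIntegrable_horizontal (by linarith) fun x _ =>
        differentiableAt_logIntegrand hne ?_ (Or.inr ?_)
      · rw [← hθ, add_sub_cancel_left, abs_of_pos hpi]
      · rw [← hθ, add_sub_cancel_left, abs_of_pos hpi]; linarith
  rw [hhor] at hG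
  rw [hlin, hlin]
  simp only [one_mul, neg_mul]
  have hG' : 8 * (Real.pi : ℂ) ^ 2 * green m t = -(2 * Real.pi) * (∫ x in (-L)..L, cutKernel m t x)
      + (∫ y in (θ - Real.pi)..(θ + Real.pi), logIntegrand m t (L + y * Complex.I))
      - ∫ y in (θ - Real.pi)..(θ + Real.pi), logIntegrand m t ((-L : ℝ) + y * Complex.I) := by
    apply mul_left_cancel₀ Complex.I_ne_zero
    linear_combination hG
  have h3 : 4 * (Real.pi : ℂ) * green m t
      = 8 * (Real.pi : ℂ) ^ 2 * green m t * (1 / (2 * Real.pi)) := by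
    field_simp
    ring
  rw [h3, hG']
  generalize (∫ y in (θ - Real.pi)..(θ + Real.pi), logIntegrand m t (L + y * Complex.I)) = P
  generalize (∫ y in (θ - Real.pi)..(θ + Real.pi), logIntegrand m t ((-L : ℝ) + y * Complex.I)) = Q
  generalize (∫ x in (-L)..L, cutKernel m t x) = R
  generalize (∫ y in (θ - Real.pi)..(θ + Real.pi), (y : ℂ) * Complex.I) = S
  push_cast
  field_simp
  ring

/-! ### Asymptotics of the Green's function -/

theorem norm_cutKernel_sub_le {m : ℤ} {t : ℝ} (hr : 1 ≤ ‖point 1 m t‖) {x : ℝ} (hx : x ≤ 0) :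
    ‖cutKernel m t x - (Real.exp (-(4 * ‖point 1 m t‖ * Real.exp x)) : ℝ)‖
      ≤ 16 * (‖point 1 m t‖ * Real.exp x ^ 3 * Real.exp (-(2 * ‖point 1 m t‖ * Real.exp x)))
    ∧ ‖cutKernel m t (-x) - (Real.exp (-(4 * ‖point 1 m t‖ * Real.exp x)) : ℝ)‖
      ≤ 16 * (‖point 1 m t‖ * Real.exp x ^ 3 * Real.exp (-(2 * ‖point 1 m t‖ * Real.exp x))) := by
  set r := ‖point 1 m t‖ with hrdef
  have hm : (m : ℝ) = r * Real.cos (angle m t) := by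
    rw [hrdef, angle, Complex.norm_mul_cos_arg]
    simp [point]
  have ht : t = r * Real.sin (angle m t) := by
    rw [hrdef, angle, Complex.norm_mul_sin_arg]
    simp [point]
  have h1 := norm_kernel_sub_exp_le hr (Real.exp_pos x) (Real.exp_le_one_iff.2 hx)
    (Real.cos_sq_add_sin_sq (angle m t)) hm ht
  refine ⟨h1, ?_⟩
  -- On the unit circle `z` may equal `±1`, which `kernel_inv` excludes; there the two claims
  -- coincide.
  rcases hx.eq_or_lt with rfl | hx
  · rw [neg_zero]
    exact h1
  set e : ℂ := Real.cos (angle m t) + Real.sin (angle m t) * Complex.I with he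
  have hee : e * (starRingEnd ℂ) e = 1 := by
    rw [Complex.mul_conj, he, Complex.normSq_add_mul_I, Real.cos_sq_add_sin_sq, Complex.ofReal_one]
  set z : ℂ := -(Real.exp x * e) with hz
  have hxC : (Real.exp (-x) : ℂ) * Real.exp x = 1 := by
    rw [← Complex.ofReal_mul, ← Real.exp_add, neg_add_cancel, Real.exp_zero, Complex.ofReal_one]
  have hmul : -(Real.exp (-x) * e) * (starRingEnd ℂ) z = 1 := by
    rw [hz, map_neg, map_mul, Complex.conj_ofReal, neg_mul_neg, mul_mul_mul_comm, hxC, hee, mul_one]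
  have hnorm : ‖(starRingEnd ℂ) z‖ < 1 := by
    have hen : ‖e‖ = 1 := by
      rw [he, Complex.norm_add_mul_I, Real.cos_sq_add_sin_sq, Real.sqrt_one]
    rw [Complex.norm_conj, hz, norm_neg, norm_mul, hen, mul_one, Complex.norm_real,
      Real.norm_eq_abs, abs_of_pos (Real.exp_pos x)]
    simpa using hx
  have hz0 : (starRingEnd ℂ) z ≠ 0 := right_ne_zero_of_mul_eq_one hmul
  have hinv := eq_inv_of_mul_eq_one_left hmul
  have hconj : cutKernel m t (-x) = (starRingEnd ℂ) (kernel m t z) := by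
    rw [cutKernel, ← he, hinv, kernel_inv m t hz0, conj_kernel]
    · intro h
      rw [h, norm_one] at hnorm
      exact lt_irrefl _ hnorm
    · intro h
      rw [h, norm_neg, norm_one] at hnorm
      exact lt_irrefl _ hnorm
  rw [hconj, ← Complex.conj_ofReal, ← map_sub, Complex.norm_conj]
  exact h1

/-- Each half of the cut is compared with `exp(-4r exp x)` at cost `16/(4r²)`, giving `8/r²`. The
two exponential tails cost at most `4/r²`, and the factor `1/(4π) ≤ 1` is discarded. -/
theorem norm_green_sub_le {m : ℤ} {t : ℝ} (hr : 1 ≤ ‖point 1 m t‖) :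
    ‖green m t - ((1 / (2 * Real.pi) * Real.log (4 * ‖point 1 m t‖)
        + Real.eulerMascheroniConstant / (2 * Real.pi) : ℝ) : ℂ)‖ ≤ 12 / ‖point 1 m t‖ ^ 2 := by
  set r := ‖point 1 m t‖ with hrdef
  have hr0 : 0 < r := by linarith
  have hpi := Real.pi_gt_three
  have hne : t ≠ 0 ∨ m ≠ 0 := by
    by_contra! h
    have : r = 0 := by simp [hrdef, point, h.1, h.2]
    linarith
  set E : ℝ → ℝ := fun x => Real.exp (-(4 * r * Real.exp x)) with hE
  have hT := tendsto_sub_integral_cutKernel hne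
  have hU := ((tendsto_sub_integral_exp_neg_mul_exp (a := 4 * r) (by positivity)).const_mul 2)
  have hU' := (Complex.continuous_ofReal.tendsto _).comp hU
  have hdiff := (hT.sub hU').norm
  have hbound : ∀ᶠ L : ℝ in atTop, ‖((2 * L : ℂ) - ∫ x in (-L)..L, cutKernel m t x)
      - ((2 * (L - ∫ x in (-L)..0, E x) : ℝ) : ℂ)‖ ≤ 8 / r ^ 2 := by
    filter_upwards [eventually_ge_atTop 0] with L hL
    have hcont := continuous_cutKernel hne
    have hcut : ∀ a b : ℝ, IntervalIntegrable (cutKernel m t) volume a b :=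
      fun _ _ => hcont.intervalIntegrable _ _
    have hEi : IntervalIntegrable (fun x => (E x : ℂ)) volume (-L) 0 :=
      Continuous.intervalIntegrable (by fun_prop) _ _
    have hcutn : IntervalIntegrable (fun x => cutKernel m t (-x)) volume (-L) 0 :=
      (hcont.comp continuous_neg).intervalIntegrable _ _
    have hsplit : ((2 * L : ℂ) - ∫ x in (-L)..L, cutKernel m t x)
        - ((2 * (L - ∫ x in (-L)..0, E x) : ℝ) : ℂ)
        = -((∫ x in (-L)..0, (cutKernel m t x - E x))
          + ∫ x in (-L)..0, (cutKernel m t (-x) - E x)) := by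
      rw [intervalIntegral.integral_sub (hcut _ _) hEi, intervalIntegral.integral_sub hcutn hEi,
        intervalIntegral.integral_comp_neg, neg_zero, neg_neg, intervalIntegral.integral_ofReal,
        ← intervalIntegral.integral_add_adjacent_intervals (hcut (-L) 0) (hcut 0 L)]
      push_cast
      ring
    have hcubic := integral_cubic_exp_le hr0 L
    have hci : IntervalIntegrable
        (fun x => 16 * (r * Real.exp x ^ 3 * Real.exp (-(2 * r * Real.exp x)))) volume (-L) 0 :=
      Continuous.intervalIntegrable (by fun_prop) _ _
    have hI1 := intervalIntegral.norm_integral_le_of_norm_le (f := fun x => cutKernel m t x - E x)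
      (by linarith : -L ≤ 0)
      (Eventually.of_forall fun x hx => (norm_cutKernel_sub_le hr hx.2).1) hci
    have hI2 := intervalIntegral.norm_integral_le_of_norm_le
      (f := fun x => cutKernel m t (-x) - E x) (by linarith : -L ≤ 0)
      (Eventually.of_forall fun x hx => (norm_cutKernel_sub_le hr hx.2).2) hci
    rw [intervalIntegral.integral_const_mul] at hI1 hI2
    rw [hsplit, norm_neg]
    refine (norm_add_le _ _).trans ?_
    have : 8 / r ^ 2 = 16 * (1 / (4 * r ^ 2)) + 16 * (1 / (4 * r ^ 2)) := by
      field_simp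
      norm_num
    linarith
  have hlim := le_of_tendsto hdiff hbound
  have htail := abs_expIntegralTail_le (a := 4 * r) (by linarith)
  have hdecomp : green m t - ((1 / (2 * Real.pi) * Real.log (4 * r)
        + Real.eulerMascheroniConstant / (2 * Real.pi) : ℝ) : ℂ)
      = ((1 / (4 * Real.pi) : ℝ) : ℂ) * ((4 * Real.pi * green m t
        - ((2 * (Real.log (4 * r) + Real.eulerMascheroniConstant + expIntegralTail (4 * r)) : ℝ) : ℂ))
        + ((2 * expIntegralTail (4 * r) : ℝ) : ℂ)) := by
    have hpiC : (Real.pi : ℂ) ≠ 0 := Complex.ofReal_ne_zero.2 Real.pi_ne_zero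
    push_cast
    field_simp
    ring
  rw [hdecomp, norm_mul, Complex.norm_real, Real.norm_eq_abs, abs_of_pos (by positivity)]
  have h2 : ‖((2 * expIntegralTail (4 * r) : ℝ) : ℂ)‖ ≤ 4 / r ^ 2 := by
    rw [Complex.norm_real, Real.norm_eq_abs, abs_mul, abs_two]
    calc 2 * |expIntegralTail (4 * r)| ≤ 2 * (18 / (4 * r) ^ 2) := by gcongr
      _ = (9 / 4) / r ^ 2 := by field_simp; norm_num
      _ ≤ 4 / r ^ 2 := by gcongr; norm_num
  have h3 : 1 / (4 * Real.pi) ≤ 1 := by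
    rw [div_le_one (by positivity)]; linarith
  calc _ ≤ 1 * (8 / r ^ 2 + 4 / r ^ 2) := by
        refine mul_le_mul h3 ((norm_add_le _ _).trans (add_le_add hlim h2)) (norm_nonneg _) zero_le_one
    _ = 12 / r ^ 2 := by ring

theorem norm_point (δ : ℝ) (hδ : 0 < δ) (m : ℤ) (t : ℝ) :
    ‖point δ m t‖ = δ * ‖point 1 m (t / δ)‖ := by
  have : point δ m t = (δ : ℂ) * point 1 m (t / δ) := by
    have hδ' : (δ : ℂ) ≠ 0 := Complex.ofReal_ne_zero.2 hδ.ne'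
    simp only [point]
    push_cast
    field_simp
  rw [this, norm_mul, Complex.norm_real, Real.norm_eq_abs, abs_of_pos hδ]

end SemiDiscrete

end

theorem proposition3p12 :
    (∃ K N : ℝ, 0 < N ∧ ∀ (m : ℤ) (t : ℝ), N ≤ ‖SemiDiscrete.point 1 m t‖ →
      ‖SemiDiscrete.green m t
          - ((1 / (2 * Real.pi) * Real.log (4 * ‖SemiDiscrete.point 1 m t‖)
              + Real.eulerMascheroniConstant / (2 * Real.pi) : ℝ) : ℂ)‖
        ≤ K / ‖SemiDiscrete.point 1 m t‖ ^ 2)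
    ∧
    (∃ K N : ℝ, 0 < N ∧ ∀ δ : ℝ, 0 < δ → ∀ (m : ℤ) (t : ℝ),
      N ≤ ‖SemiDiscrete.point δ m t‖ / δ →
      ‖SemiDiscrete.greenScaled δ m t
          - ((1 / (2 * Real.pi) * Real.log ‖SemiDiscrete.point δ m t‖ : ℝ) : ℂ)‖
        ≤ K * (δ ^ 2 / ‖SemiDiscrete.point δ m t‖ ^ 2)) := by
  refine ⟨⟨12, 1, one_pos, fun m t h => SemiDiscrete.norm_green_sub_le h⟩,
    ⟨12, 1, one_pos, fun δ hδ m t h => ?_⟩⟩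
  rw [SemiDiscrete.norm_point δ hδ, mul_div_cancel_left₀ _ hδ.ne'] at h
  rw [SemiDiscrete.norm_point δ hδ, SemiDiscrete.greenScaled]
  set r := ‖SemiDiscrete.point 1 m (t / δ)‖ with hr
  have hr0 : 0 < r := by linarith
  have hmain := SemiDiscrete.norm_green_sub_le (m := m) (t := t / δ) h
  rw [← hr] at hmain
  have e1 : 12 * (δ ^ 2 / (δ * r) ^ 2) = 12 / r ^ 2 := by
    field_simp
  rw [e1]
  convert hmain using 2
  -- The additive constant of `greenScaled` turns `log(4r) + γ` into `log(δ r)`.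
  rw [Real.log_mul hδ.ne' hr0.ne', Real.log_mul (by norm_num) hr0.ne']
  push_cast
  ring
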